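/- Let $d\ge 1$, $\sigma>0$, and let $(X_i,Y_i)_{i=1}^n$ be i.i.d. with $Y_i=f^\circ(X_i)+\xi_i$, where $X_i$ is uniform on $[0,1]^d$ and $\xi_i\sim N(0,\sigma^2)$ is independent of $X_i$. For $\mathcal F\subset L^2([0,1]^d)$ the minimax $L^2$ risk over $\mathcal F$ is $\inf_{\hat f}\sup_{f^\circ\in\mathcal F}\mathrm E\,\|\hat f-f^\circ\|_{L^2}^2$, where $\hat f$ runs over all measurable maps from the data $(X_i,Y_i)_{i=1}^n$ to $L^2([0,1]^d)$. For a sequence $a\in\ell^2$ let $|a|_{(i)}$ be the $i$-th largest absolute value of its terms and, for $0<p<2$, put $\|a\|_{w\ell^p}:=\sup_{i\ge1}i^{1/p}|a|_{(i)}$. For an orthonormal sequence $\phi=(\phi_i)_{i=1}^\infty$ in $L^2([0,1]^d)$ and constants $C_1,C_2,\beta>0$ let $$\mathcal I^p_\phi(C_1,C_2,\beta):=\Big\{\sum_{i=1}^\infty a_i\phi_i \;\Big|\; \|a\|_{w\ell^p}\le C_1,\ \sum_{i=m+1}^\infty a_i^2\le C_2m^{-\beta},\ m=1,2,\dots\Big\}.$$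 **Theorem.** Let $0<p<2$, $C_1,C_2,\sigma>0$ and $\alpha:=1/p-1/2$. There exists a constant $C>0$ depending only on $p,C_1,C_2,\sigma$ such that, for every $d$, every orthonormal sequence $\phi$ in $L^2([0,1]^d)$ and every $\beta$ with $0<\beta\le2\alpha$, $$\inf_{\hat f}\ \sup_{f^\circ\in\mathcal I^p_\phi(C_1,C_2,\beta)}\mathrm E\,\|\hat f-f^\circ\|_{L^2}^2\ \ge\ C\,n^{-\frac{2\alpha}{2\alpha+1}}(\log n)^{-\frac{4\alpha^2}{2\alpha+1}}\qquad\text{for all } n\ge2.$$ -/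

import Mathlib

open MeasureTheory ProbabilityTheory
open scoped ENNReal

noncomputable section

/-- The uniform distribution on the cube `[0,1]^d`. -/
def cubeMeasure (d : ℕ) : Measure (Fin d → ℝ) :=
  (volume : Measure (Fin d → ℝ)).restrict (Set.Icc 0 1)

/-- The Hilbert space `L²([0,1]^d)`. -/
abbrev L2Cube (d : ℕ) : Type := Lp ℝ 2 (cubeMeasure d)

/-- The law of one observation `(X, Y)` with `Y = f(X) + ξ`, where `X` is uniform on `[0,1]^d` and
`ξ` is centered Gaussian with variance `σ²`, independent of `X`. -/
def observationLaw {d : ℕ} (σ : ℝ) (f : L2Cube d) : Measure ((Fin d → ℝ) × ℝ) :=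
  ((cubeMeasure d).prod (gaussianReal 0 (Real.toNNReal (σ ^ 2)))).map
    (fun w => (w.1, f w.1 + w.2))

/-- The law of `n` i.i.d. observations `(X_i, Y_i)` with regression function `f`. -/
def sampleLaw {d : ℕ} (σ : ℝ) (n : ℕ) (f : L2Cube d) : Measure (Fin n → (Fin d → ℝ) × ℝ) :=
  Measure.pi (fun _ => observationLaw σ f)

/-- Estimators based on `n` observations: Borel measurable maps from the data to `L²([0,1]^d)`. -/
def IsEstimator {d n : ℕ} (fhat : (Fin n → (Fin d → ℝ) × ℝ) → L2Cube d) : Prop :=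
  Measurable[_, borel (L2Cube d)] fhat

/-- The `L²` risk `E ‖fhat - f‖²` when the true regression function is `f`. -/
def l2Risk {d n : ℕ} (σ : ℝ) (fhat : (Fin n → (Fin d → ℝ) × ℝ) → L2Cube d) (f : L2Cube d) :
    ℝ≥0∞ :=
  ∫⁻ z, ‖fhat z - f‖ₑ ^ 2 ∂(sampleLaw σ n f)

/-- The minimax `L²` risk over a model `F`, for `n` observations. -/
def minimaxRisk {d : ℕ} (σ : ℝ) (n : ℕ) (F : Set (L2Cube d)) : ℝ≥0∞ :=
  ⨅ (fhat : (Fin n → (Fin d → ℝ) × ℝ) → L2Cube d) (_ : IsEstimator fhat),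
    ⨆ f ∈ F, l2Risk σ fhat f

/-- The `i`-th largest absolute value (`i ≥ 1`, with multiplicity) of the terms of `a`: the least
`t ≥ 0` such that fewer than `i` terms exceed `t` in absolute value. -/
def nthLargestAbs (a : ℕ → ℝ) (i : ℕ) : ℝ :=
  sInf {t : ℝ | 0 ≤ t ∧ {j | t < |a j|}.encard < (i : ℕ∞)}

/-- The weak `ℓ^p` norm `sup_{i ≥ 1} i^{1/p} |a|_{(i)}`, with values in `[0, ∞]`. -/
def weakLpNorm (p : ℝ) (a : ℕ → ℝ) : ℝ≥0∞ :=
  ⨆ (i : ℕ) (_ : 1 ≤ i), ENNReal.ofReal ((i : ℝ) ^ (1 / p) * nthLargestAbs a i)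

/-- The set of all `∑ a_i φ_i` with `a ∈ ℓ²`, weak `ℓ^p` norm at most `C₁` and tails
`∑_{i > m} a_i² ≤ C₂ m^{-β}` for `m = 1, 2, …`. The `i`-th term of a sequence, `i ≥ 1`, is stored
at the index `i - 1`, so the tail after `m` terms runs over the indices `m, m + 1, …`. -/
def sparseApproxSet {d : ℕ} (φ : ℕ → L2Cube d) (p C₁ C₂ β : ℝ) : Set (L2Cube d) :=
  {f | ∃ a : ℕ → ℝ, Memℓp a 2 ∧ HasSum (fun i => a i • φ i) f ∧
    weakLpNorm p a ≤ ENNReal.ofReal C₁ ∧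
    ∀ m : ℕ, 1 ≤ m → ∑' i : ℕ, a (m + i) ^ 2 ≤ C₂ * (m : ℝ) ^ (-β)}

end

/-! The class contains a cube of dimension `k` that is too small to be resolved from `n`
observations. Its vertices have coefficients `0` or `ε` on the first `k` of the `φ i`. With `ε = c
k^(-1/p)` the weak `ℓ^p` norm is at most `c`, and the energy is at most `k ε² = c² k^(-2α)`, which
for small `c` meets the tail condition for every `β ≤ 2α`.

Neighbouring vertices are at distance `ε`. By the Gaussian noise their one-observation Hellinger
affinity is at least `1 - ε²/(8σ²)`, so `n` observations cannot separate them when `n ε² ≤ 4σ²`.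
Hence every estimator errs by order `ε²` in each of the `k` directions, on average over the vertices
(Assouad), and its risk is at least `k ε²/16`. As `ε² = c² k^(-(2α+1))`, the choice `k ≈
n^(1/(2α+1))` is admissible and gives `n^(-2α/(2α+1))`, with no logarithm; the logarithmic factor in
the claim only weakens it. -/

/-! ### Product densities, Hellinger affinity and Le Cam's two-point bound -/

/-- Tonelli's theorem for a product of functions of separate coordinates. -/
theorem lintegral_fin_prod_eq_prod {E : Type*} [MeasurableSpace E] {μ : Measure E} [SigmaFinite μ]
    {n : ℕ} (f : Fin n → E → ℝ≥0∞) (hf : ∀ i, Measurable (f i)) :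
    ∫⁻ x, ∏ i, f i (x i) ∂(Measure.pi fun _ => μ) = ∏ i, ∫⁻ x, f i x ∂μ := by
  induction n with
  | zero => simp
  | succ n ih =>
    have hm : Measurable fun y : Fin n → E => ∏ i, f i.succ (y i) :=
      Finset.measurable_prod _ fun i _ => (hf i.succ).comp (measurable_pi_apply i)
    rw [← (measurePreserving_piFinSuccAbove (fun _ : Fin (n + 1) => μ) 0).symm.lintegral_comp_emb
      (MeasurableEquiv.measurableEmbedding _)]
    simp only [MeasurableEquiv.piFinSuccAbove_symm_apply, Fin.insertNthEquiv,
      Fin.prod_univ_succ, Fin.insertNth_zero, Equiv.coe_fn_mk, Fin.cons_succ, Fin.zero_succAbove,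
      cast_eq, Fin.cons_zero]
    rw [lintegral_prod_mul (hf 0).aemeasurable hm.aemeasurable, ih _ fun i => hf i.succ]

/-- A power of a measure with density has the product density. -/
theorem pi_withDensity {E : Type*} [MeasurableSpace E] {μ : Measure E} [SigmaFinite μ]
    {n : ℕ} {p : E → ℝ≥0∞} (hp : Measurable p) [SigmaFinite (μ.withDensity p)] :
    Measure.pi (fun _ : Fin n => μ.withDensity p) =
      (Measure.pi fun _ : Fin n => μ).withDensity (fun z => ∏ i, p (z i)) := by
  refine Measure.pi_eq fun s hs => ?_
  rw [withDensity_apply _ (MeasurableSet.univ_pi hs), ← lintegral_indicator (MeasurableSet.univ_pi hs)]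
  have h : (Set.univ.pi s).indicator (fun z : Fin n → E => ∏ i, p (z i)) =
      fun z => ∏ i, (s i).indicator p (z i) := by
    ext z
    by_cases hz : z ∈ Set.univ.pi s
    · rw [Set.indicator_of_mem hz]
      exact Finset.prod_congr rfl fun i _ => (Set.indicator_of_mem (hz i trivial) _).symm
    · rw [Set.indicator_of_notMem hz]
      simp only [Set.mem_pi, Set.mem_univ, true_imp_iff, not_forall] at hz
      obtain ⟨i, hi⟩ := hz
      exact (Finset.prod_eq_zero (Finset.mem_univ i) (Set.indicator_of_notMem hi _)).symm
  rw [h, lintegral_fin_prod_eq_prod _ fun i => hp.indicator (hs i)]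
  refine Finset.prod_congr rfl fun i _ => ?_
  rw [lintegral_indicator (hs i), withDensity_apply _ (hs i)]

/-- The Hellinger affinity of product densities is the product of the affinities. -/
theorem lintegral_sqrt_prod_mul_prod {E : Type*} [MeasurableSpace E] {μ : Measure E} [SigmaFinite μ]
    {n : ℕ} {p q : E → ℝ≥0∞} (hp : Measurable p) (hq : Measurable q) :
    ∫⁻ z, ((∏ i, p (z i)) * ∏ i, q (z i)) ^ (1 / 2 : ℝ) ∂(Measure.pi fun _ : Fin n => μ) =
      (∫⁻ x, (p x * q x) ^ (1 / 2 : ℝ) ∂μ) ^ n := by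
  simp_rw [← Finset.prod_mul_distrib, ← ENNReal.prod_rpow_of_nonneg (by norm_num : (0:ℝ) ≤ 1 / 2)]
  rw [lintegral_fin_prod_eq_prod (fun _ x => (p x * q x) ^ (1 / 2 : ℝ))
    fun _ => (hp.mul hq).pow_const _]
  simp

/-- Cauchy–Schwarz with respect to two densities. -/
theorem sq_lintegral_sqrt_mul_le {Ω : Type*} [MeasurableSpace Ω] {μ : Measure Ω}
    {p q A : Ω → ℝ≥0∞} (hp : Measurable p) (hq : Measurable q) (hA : Measurable A)
    (hq1 : ∫⁻ z, q z ∂μ ≤ 1) :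
    (∫⁻ z, (p z * q z) ^ (1 / 2 : ℝ) * A z ∂μ) ^ 2 ≤ ∫⁻ z, A z ^ 2 ∂(μ.withDensity p) := by
  have hA2 : Measurable fun z => A z ^ 2 := hA.pow_const 2
  have hsq : ∀ x : ℝ≥0∞, (x ^ (1 / 2 : ℝ)) ^ 2 = x := fun x => by
    rw [← ENNReal.rpow_natCast, ← ENNReal.rpow_mul]; norm_num
  -- `A` is grouped with `√p`, so that the other factor `√q` contributes only the mass of `q`, at
  -- most 1.
  have key := ENNReal.lintegral_mul_le_Lp_mul_Lq μ Real.HolderConjugate.two_two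
    (f := fun z => p z ^ (1 / 2 : ℝ) * A z) (g := fun z => q z ^ (1 / 2 : ℝ))
    ((hp.pow_const _).mul hA).aemeasurable (hq.pow_const _).aemeasurable
  simp only [Pi.mul_apply, ENNReal.rpow_two, mul_pow, hsq] at key
  rw [lintegral_withDensity_eq_lintegral_mul _ hp hA2]
  calc (∫⁻ z, (p z * q z) ^ (1 / 2 : ℝ) * A z ∂μ) ^ 2
      = (∫⁻ z, p z ^ (1 / 2 : ℝ) * A z * q z ^ (1 / 2 : ℝ) ∂μ) ^ 2 := by
        congr 1
        refine lintegral_congr fun z => ?_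
        rw [ENNReal.mul_rpow_of_nonneg _ _ (by norm_num)]
        ring
    _ ≤ ((∫⁻ z, p z * A z ^ 2 ∂μ) ^ (1 / 2 : ℝ) * (∫⁻ z, q z ∂μ) ^ (1 / 2 : ℝ)) ^ 2 := by
        gcongr
    _ = (∫⁻ z, p z * A z ^ 2 ∂μ) * ∫⁻ z, q z ∂μ := by rw [mul_pow, hsq, hsq]
    _ ≤ (∫⁻ z, p z * A z ^ 2 ∂μ) * 1 := by gcongr
    _ = _ := by rw [mul_one]; rfl

/-- Le Cam's two-point bound for the squared loss, in terms of the Hellinger affinity. -/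
theorem two_point_lower_bound {Ω : Type*} [MeasurableSpace Ω] {μ : Measure Ω}
    {p q A B : Ω → ℝ≥0∞} (hp : Measurable p) (hq : Measurable q) (hA : Measurable A)
    (hB : Measurable B) (hp1 : ∫⁻ z, p z ∂μ ≤ 1) (hq1 : ∫⁻ z, q z ∂μ ≤ 1) {Δ : ℝ≥0∞}
    (hΔ : ∀ z, Δ ≤ A z + B z) :
    ((∫⁻ z, (p z * q z) ^ (1 / 2 : ℝ) ∂μ) * Δ) ^ 2 ≤
      2 * (∫⁻ z, A z ^ 2 ∂(μ.withDensity p) + ∫⁻ z, B z ^ 2 ∂(μ.withDensity q)) := by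
  have hs : Measurable fun z => (p z * q z) ^ (1 / 2 : ℝ) := (hp.mul hq).pow_const _
  have h1 := sq_lintegral_sqrt_mul_le hp hq hA hq1
  have h2 := sq_lintegral_sqrt_mul_le hq hp hB hp1
  simp_rw [mul_comm (q _) (p _)] at h2
  calc ((∫⁻ z, (p z * q z) ^ (1 / 2 : ℝ) ∂μ) * Δ) ^ 2
      = (∫⁻ z, (p z * q z) ^ (1 / 2 : ℝ) * Δ ∂μ) ^ 2 := by rw [lintegral_mul_const _ hs]
    _ ≤ (∫⁻ z, (p z * q z) ^ (1 / 2 : ℝ) * (A z + B z) ∂μ) ^ 2 := by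
        gcongr with z
        exact hΔ z
    _ = (∫⁻ z, (p z * q z) ^ (1 / 2 : ℝ) * A z ∂μ
          + ∫⁻ z, (p z * q z) ^ (1 / 2 : ℝ) * B z ∂μ) ^ 2 := by
        simp_rw [mul_add]
        rw [← lintegral_add_left (f := fun z => (p z * q z) ^ (1 / 2 : ℝ) * A z) (hs.mul hA)]
    _ ≤ 2 * ((∫⁻ z, (p z * q z) ^ (1 / 2 : ℝ) * A z ∂μ) ^ 2
          + (∫⁻ z, (p z * q z) ^ (1 / 2 : ℝ) * B z ∂μ) ^ 2) := by
        have := ENNReal.rpow_add_le_mul_rpow_add_rpow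
          (∫⁻ z, (p z * q z) ^ (1 / 2 : ℝ) * A z ∂μ)
          (∫⁻ z, (p z * q z) ^ (1 / 2 : ℝ) * B z ∂μ) (one_le_two : (1 : ℝ) ≤ 2)
        simpa [show (2 : ℝ) - 1 = 1 by norm_num] using this
    _ ≤ _ := by gcongr

/-! ### Affinity in the Gaussian regression model -/

/-- The Hellinger affinity of two Gaussians with the same variance. -/
theorem lintegral_sqrt_gaussianPDF_mul (a b : ℝ) {v : NNReal} (hv : v ≠ 0) :
    ∫⁻ y, (gaussianPDF a v y * gaussianPDF b v y) ^ (1 / 2 : ℝ) =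
      ENNReal.ofReal (Real.exp (-(a - b) ^ 2 / (8 * v))) := by
  have hv' : (v : ℝ) ≠ 0 := by exact_mod_cast hv
  -- Completing the square: the geometric mean of the two densities is a multiple of the Gaussian
  -- density centred at the midpoint.
  have hpt : ∀ y, (gaussianPDF a v y * gaussianPDF b v y) ^ (1 / 2 : ℝ) =
      ENNReal.ofReal (Real.exp (-(a - b) ^ 2 / (8 * v))) * gaussianPDF ((a + b) / 2) v y := by
    intro y
    have ha := gaussianPDFReal_nonneg a v y
    have hb := gaussianPDFReal_nonneg b v y
    rw [gaussianPDF, gaussianPDF, gaussianPDF, ← ENNReal.ofReal_mul ha,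
      ENNReal.ofReal_rpow_of_nonneg (mul_nonneg ha hb) (by norm_num),
      ← ENNReal.ofReal_mul (Real.exp_nonneg _)]
    congr 1
    rw [← Real.sqrt_eq_rpow, Real.sqrt_eq_iff_mul_self_eq (mul_nonneg ha hb)
      (mul_nonneg (Real.exp_nonneg _) (gaussianPDFReal_nonneg _ _ _))]
    symm
    simp only [gaussianPDFReal]
    set c := (√(2 * Real.pi * v))⁻¹
    calc _ = c * c * ((Real.exp (-(a - b) ^ 2 / (8 * v)) * Real.exp (-(a - b) ^ 2 / (8 * v))) *
            (Real.exp (-(y - (a + b) / 2) ^ 2 / (2 * v)) *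
              Real.exp (-(y - (a + b) / 2) ^ 2 / (2 * v)))) := by ring
      _ = c * c * (Real.exp (-(y - a) ^ 2 / (2 * v)) * Real.exp (-(y - b) ^ 2 / (2 * v))) := by
          congr 1
          simp only [← Real.exp_add]
          congr 1
          field_simp
          ring
      _ = _ := by ring
  simp_rw [hpt]
  rw [lintegral_const_mul _ (measurable_gaussianPDF _ _), lintegral_gaussianPDF_eq_one _ hv, mul_one]

instance isProbabilityMeasure_cubeMeasure (d : ℕ) : IsProbabilityMeasure (cubeMeasure d) :=
  ⟨by rw [cubeMeasure, Measure.restrict_apply_univ, Real.volume_Icc_pi]; simp⟩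

instance isProbabilityMeasure_observationLaw {d : ℕ} (σ : ℝ) (f : L2Cube d) :
    IsProbabilityMeasure (observationLaw σ f) := by
  have hf : Measurable f := (Lp.stronglyMeasurable f).measurable
  exact Measure.isProbabilityMeasure_map (by fun_prop)

/-- The density of one observation. -/
noncomputable def observationPDF {d : ℕ} (σ : ℝ) (f : L2Cube d) (z : (Fin d → ℝ) × ℝ) : ℝ≥0∞ :=
  gaussianPDF (f z.1) (Real.toNNReal (σ ^ 2)) z.2

theorem measurable_observationPDF {d : ℕ} (σ : ℝ) (f : L2Cube d) :
    Measurable (observationPDF σ f) := by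
  have hf : Measurable f := (Lp.stronglyMeasurable f).measurable
  exact measurable_uncurry_gaussianPDF.comp
    ((hf.comp measurable_fst).prodMk (measurable_const.prodMk measurable_snd))

theorem observationLaw_eq_withDensity {d : ℕ} {σ : ℝ} (hσ : 0 < σ) (f : L2Cube d) :
    observationLaw σ f =
      ((cubeMeasure d).prod (volume : Measure ℝ)).withDensity (observationPDF σ f) := by
  have hf : Measurable f := (Lp.stronglyMeasurable f).measurable
  have hT : Measurable fun w : (Fin d → ℝ) × ℝ => (w.1, f w.1 + w.2) := by fun_prop
  have hv : Real.toNNReal (σ ^ 2) ≠ 0 := by simp [hσ.ne']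
  ext s hs
  rw [observationLaw, Measure.map_apply hT hs, Measure.prod_apply (hT hs),
    withDensity_apply _ hs, ← lintegral_indicator hs,
    lintegral_prod _ ((measurable_observationPDF σ f).indicator hs).aemeasurable]
  refine lintegral_congr fun x => ?_
  have hsx : MeasurableSet (Prod.mk x ⁻¹' s) := measurable_prodMk_left hs
  calc _ = (gaussianReal 0 (Real.toNNReal (σ ^ 2))).map (f x + ·) (Prod.mk x ⁻¹' s) := by
        rw [Measure.map_apply (by fun_prop) hsx]; rfl
    _ = _ := by
        rw [gaussianReal_map_const_add, zero_add, gaussianReal_of_var_ne_zero _ hv,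
          withDensity_apply _ hsx, ← lintegral_indicator hsx]
        rfl

/-- A lower bound for the Hellinger affinity of the laws of one observation. -/
theorem one_sub_le_observation_affinity {d : ℕ} {σ : ℝ} (hσ : 0 < σ) (f g : L2Cube d) :
    ENNReal.ofReal (1 - ‖f - g‖ ^ 2 / (8 * σ ^ 2)) ≤
      ∫⁻ z, (observationPDF σ f z * observationPDF σ g z) ^ (1 / 2 : ℝ)
        ∂((cubeMeasure d).prod (volume : Measure ℝ)) := by
  have hf : Measurable f := (Lp.stronglyMeasurable f).measurable
  have hg : Measurable g := (Lp.stronglyMeasurable g).measurable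
  have hv : Real.toNNReal (σ ^ 2) ≠ 0 := by simp [hσ.ne']
  have hvσ : ((Real.toNNReal (σ ^ 2) : NNReal) : ℝ) = σ ^ 2 := Real.coe_toNNReal _ (sq_nonneg σ)
  rw [lintegral_prod (fun z => (observationPDF σ f z * observationPDF σ g z) ^ (1 / 2 : ℝ))
    (((measurable_observationPDF σ f).mul
      (measurable_observationPDF σ g)).pow_const _).aemeasurable]
  simp only [observationPDF, lintegral_sqrt_gaussianPDF_mul _ _ hv, hvσ]
  have hint : Integrable (fun x => (f x - g x) ^ 2) (cubeMeasure d) :=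
    ((Lp.memLp f).sub (Lp.memLp g)).integrable_sq
  have hnorm : ∫ x, (f x - g x) ^ 2 ∂(cubeMeasure d) = ‖f - g‖ ^ 2 := by
    rw [← real_inner_self_eq_norm_sq, L2.inner_def]
    refine integral_congr_ae ?_
    filter_upwards [Lp.coeFn_sub f g] with x hx
    rw [hx]
    simp [pow_two]
  have hlow : ∫ x, (1 - (f x - g x) ^ 2 / (8 * σ ^ 2)) ∂(cubeMeasure d) =
      1 - ‖f - g‖ ^ 2 / (8 * σ ^ 2) := by
    rw [integral_sub (integrable_const _) (hint.div_const _), integral_div, hnorm]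
    simp
  -- The bound `1 - t ≤ exp (-t)` makes the estimate depend on `f - g` only through its `L²` norm,
  -- so no boundedness is needed.
  have hpt : ∀ x, 1 - (f x - g x) ^ 2 / (8 * σ ^ 2) ≤
      Real.exp (-(f x - g x) ^ 2 / (8 * σ ^ 2)) := fun x => by
    have := Real.add_one_le_exp (-(f x - g x) ^ 2 / (8 * σ ^ 2))
    rw [neg_div] at this ⊢
    linarith
  have hexp : Integrable (fun x => Real.exp (-(f x - g x) ^ 2 / (8 * σ ^ 2))) (cubeMeasure d) := by
    refine Integrable.of_bound (by fun_prop) 1 (Filter.Eventually.of_forall fun x => ?_)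
    rw [Real.norm_of_nonneg (Real.exp_nonneg _), Real.exp_le_one_iff, neg_div, neg_nonpos]
    positivity
  rw [← hlow, ← ofReal_integral_eq_lintegral_ofReal hexp
    (Filter.Eventually.of_forall fun x => Real.exp_nonneg _)]
  exact ENNReal.ofReal_le_ofReal
    (integral_mono ((integrable_const _).sub (hint.div_const _)) hexp hpt)

/-! ### Two-point bounds along a direction and Assouad's lemma -/

/-- Two regression functions at distance at most `2σ/√n` cannot both be estimated well in the
direction `ψ`. -/
theorem sq_enorm_inner_sub_le {d n : ℕ} {σ : ℝ} (hσ : 0 < σ) (hn : 1 ≤ n) {f g : L2Cube d}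
    (hfg : n * ‖f - g‖ ^ 2 ≤ 4 * σ ^ 2) (ψ : L2Cube d)
    {fhat : (Fin n → (Fin d → ℝ) × ℝ) → L2Cube d} (hfhat : IsEstimator fhat) :
    ‖inner ℝ ψ (f - g)‖ₑ ^ 2 ≤ 8 * (∫⁻ z, ‖inner ℝ ψ (fhat z - f)‖ₑ ^ 2 ∂(sampleLaw σ n f)
      + ∫⁻ z, ‖inner ℝ ψ (fhat z - g)‖ₑ ^ 2 ∂(sampleLaw σ n g)) := by
  let _ : MeasurableSpace (L2Cube d) := borel _
  have : BorelSpace (L2Cube d) := ⟨rfl⟩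
  have hmeas : ∀ h : L2Cube d, Measurable fun z => ‖inner ℝ ψ (fhat z - h)‖ₑ := fun h =>
    (show Continuous fun u : L2Cube d => ‖inner ℝ ψ (u - h)‖ₑ by fun_prop).measurable.comp hfhat
  have hlaw : ∀ h : L2Cube d, sampleLaw σ n h =
      (Measure.pi fun _ : Fin n => (cubeMeasure d).prod (volume : Measure ℝ)).withDensity
        (fun z => ∏ i, observationPDF σ h (z i)) := fun h => by
    have : IsProbabilityMeasure
        (((cubeMeasure d).prod (volume : Measure ℝ)).withDensity (observationPDF σ h)) := by
      rw [← observationLaw_eq_withDensity hσ]; infer_instance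
    rw [sampleLaw, observationLaw_eq_withDensity hσ, pi_withDensity (measurable_observationPDF σ h)]
  have hpdf : ∀ h : L2Cube d, Measurable fun z : Fin n → (Fin d → ℝ) × ℝ =>
      ∏ i, observationPDF σ h (z i) := fun h =>
    Finset.measurable_prod _ fun i _ => (measurable_observationPDF σ h).comp (measurable_pi_apply i)
  have hmass : ∀ h : L2Cube d, ∫⁻ z : Fin n → (Fin d → ℝ) × ℝ, ∏ i, observationPDF σ h (z i)
      ∂(Measure.pi fun _ => (cubeMeasure d).prod (volume : Measure ℝ)) ≤ 1 := fun h => by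
    rw [← setLIntegral_univ, ← withDensity_apply _ MeasurableSet.univ, ← hlaw h, sampleLaw]
    exact prob_le_one
  have key := two_point_lower_bound (hpdf f) (hpdf g) (hmeas f) (hmeas g) (hmass f) (hmass g)
    (Δ := ‖inner ℝ ψ (f - g)‖ₑ) fun z => by
      rw [show f - g = (fhat z - g) - (fhat z - f) by abel, inner_sub_right, add_comm]
      exact enorm_sub_le
  rw [← hlaw f, ← hlaw g, lintegral_sqrt_prod_mul_prod (measurable_observationPDF σ f)
    (measurable_observationPDF σ g)] at key
  -- Bernoulli's inequality: `(1 - t)^n ≥ 1 - n t ≥ 1/2`, since `n t ≤ 4σ²/(8σ²)`.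
  have haff : ENNReal.ofReal (1 / 2) ≤ (∫⁻ z, (observationPDF σ f z * observationPDF σ g z) ^
      (1 / 2 : ℝ) ∂((cubeMeasure d).prod (volume : Measure ℝ))) ^ n := by
    set t := ‖f - g‖ ^ 2 / (8 * σ ^ 2) with ht
    have ht0 : 0 ≤ t := by positivity
    have hnt : n * t ≤ 1 / 2 := by
      rw [ht, ← mul_div_assoc, div_le_iff₀ (by positivity)]
      linarith
    have hn' : (1 : ℝ) ≤ n := by exact_mod_cast hn
    have ht1 : t ≤ 1 / 2 := by nlinarith
    refine le_trans ?_ (pow_le_pow_left' (one_sub_le_observation_affinity hσ f g) n)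
    rw [← ht, ← ENNReal.ofReal_pow (by linarith)]
    refine ENNReal.ofReal_le_ofReal ?_
    have := one_add_mul_le_pow (show -2 ≤ -t by linarith) n
    rw [← sub_eq_add_neg] at this
    linarith
  have h4 : (4 : ℝ≥0∞) * ENNReal.ofReal (1 / 2) ^ 2 = 1 := by
    rw [← ENNReal.ofReal_pow (by norm_num), show (4 : ℝ≥0∞) = ENNReal.ofReal 4 by simp,
      ← ENNReal.ofReal_mul (by norm_num)]
    norm_num
  calc ‖inner ℝ ψ (f - g)‖ₑ ^ 2
      = 4 * (ENNReal.ofReal (1 / 2) * ‖inner ℝ ψ (f - g)‖ₑ) ^ 2 := by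
        rw [mul_pow, ← mul_assoc, h4, one_mul]
    _ ≤ 4 * (2 * _) := by
        gcongr
        refine le_trans ?_ key
        gcongr
    _ = _ := by rw [← mul_assoc]; norm_num

/-- The vertex of the hypercube of side `ε` spanned by `e` that is labelled by `θ`. -/
noncomputable def hypercubeVertex {d k : ℕ} (e : Fin k → L2Cube d) (ε : ℝ) (θ : Fin k → Bool) :
    L2Cube d :=
  ∑ j, (if θ j then ε else 0) • e j

/-- Assouad's lemma: the risk of an estimator over a hypercube of side `ε ≤ 2σ/√n`. -/
theorem hypercube_risk_lower_bound {d n k : ℕ} {σ : ℝ} (hσ : 0 < σ) (hn : 1 ≤ n)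
    {e : Fin k → L2Cube d} (he : Orthonormal ℝ e) {ε : ℝ} (hε : n * ε ^ 2 ≤ 4 * σ ^ 2)
    {F : Set (L2Cube d)} (hF : ∀ θ, hypercubeVertex e ε θ ∈ F)
    {fhat : (Fin n → (Fin d → ℝ) × ℝ) → L2Cube d} (hfhat : IsEstimator fhat) :
    ENNReal.ofReal (k * ε ^ 2 / 16) ≤ ⨆ f ∈ F, l2Risk σ fhat f := by
  let _ : MeasurableSpace (L2Cube d) := borel _
  have : BorelSpace (L2Cube d) := ⟨rfl⟩
  set S := ⨆ f ∈ F, l2Risk σ fhat f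
  set v := hypercubeVertex e ε with hv
  let R : (Fin k → Bool) → Fin k → ℝ≥0∞ := fun θ j =>
    ∫⁻ z, ‖inner ℝ (e j) (fhat z - v θ)‖ₑ ^ 2 ∂(sampleLaw σ n (v θ))
  let flip : Fin k → (Fin k → Bool) → (Fin k → Bool) := fun j θ => Function.update θ j (!θ j)
  have hflip : ∀ j, Function.Involutive (flip j) := fun j θ => by
    simp [flip]
  -- Bessel's inequality: the errors in the separate directions `e j` add up to at most the full
  -- risk.
  have hbessel : ∀ θ, ∑ j, R θ j ≤ S := fun θ => by
    refine le_trans ?_ (le_iSup₂ (f := fun f _ => l2Risk σ fhat f) (v θ) (hF θ))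
    rw [l2Risk, ← lintegral_finsetSum _ fun j _ => ?_]
    · refine lintegral_mono fun z => ?_
      have := he.sum_inner_products_le (s := Finset.univ) (fhat z - v θ)
      have h2 := ENNReal.ofReal_le_ofReal this
      rw [ENNReal.ofReal_sum_of_nonneg fun _ _ => by positivity] at h2
      simpa only [ENNReal.ofReal_pow (norm_nonneg _), ofReal_norm] using h2
    · exact ((show Continuous fun u : L2Cube d => ‖inner ℝ (e j) (u - v θ)‖ₑ by
        fun_prop).measurable.comp hfhat).pow_const 2
  have hdiff : ∀ j θ, ∃ s : ℝ, |s| = |ε| ∧ v θ - v (flip j θ) = s • e j := fun j θ => by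
    refine ⟨(if θ j then ε else 0) - (if flip j θ j then ε else 0), ?_, ?_⟩
    · cases h : θ j <;> simp [flip, h]
    · rw [hv, hypercubeVertex, hypercubeVertex, ← Finset.sum_sub_distrib,
        Finset.sum_eq_single j, sub_smul]
      · intro i _ hij
        simp [flip, Function.update_of_ne hij]
      · simp
  have hpair : ∀ j θ, ENNReal.ofReal (ε ^ 2) ≤ 8 * (R θ j + R (flip j θ) j) := fun j θ => by
    obtain ⟨s, hs, hsv⟩ := hdiff j θ
    have hs2 : s ^ 2 = ε ^ 2 := (sq_eq_sq_iff_abs_eq_abs _ _).2 hs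
    have hnorm : ‖v θ - v (flip j θ)‖ ^ 2 = ε ^ 2 := by
      rw [hsv, norm_smul, he.norm_eq_one, mul_one, Real.norm_eq_abs, sq_abs, hs2]
    have := sq_enorm_inner_sub_le hσ hn (by rwa [hnorm]) (e j) hfhat
      (f := v θ) (g := v (flip j θ))
    rw [hsv, inner_smul_right, real_inner_self_eq_norm_sq, he.norm_eq_one, one_pow, mul_one,
      Real.enorm_eq_ofReal_abs, ← ENNReal.ofReal_pow (abs_nonneg _), sq_abs, hs2] at this
    exact this
  -- Flipping bit `j` permutes the vertices, so summing the pair bounds counts each `R θ j` twice;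
  -- this turns 8 into 16.
  have hsum : ∀ j, 2 ^ k * ENNReal.ofReal (ε ^ 2) ≤ 16 * ∑ θ, R θ j := fun j => by
    calc 2 ^ k * ENNReal.ofReal (ε ^ 2) = ∑ _θ : Fin k → Bool, ENNReal.ofReal (ε ^ 2) := by simp
      _ ≤ ∑ θ, 8 * (R θ j + R (flip j θ) j) := Finset.sum_le_sum fun θ _ => hpair j θ
      _ = 8 * (∑ θ, R θ j + ∑ θ, R (flip j θ) j) := by
        rw [← Finset.mul_sum, Finset.sum_add_distrib]
      _ = 8 * (∑ θ, R θ j + ∑ θ, R θ j) := by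
        rw [Function.Bijective.sum_comp (hflip j).bijective fun θ => R θ j]
      _ = _ := by rw [← two_mul, ← mul_assoc]; norm_num
  have htotal : 2 ^ k * (k * ENNReal.ofReal (ε ^ 2)) ≤ 2 ^ k * (16 * S) := by
    calc 2 ^ k * (k * ENNReal.ofReal (ε ^ 2)) = ∑ _j : Fin k, 2 ^ k * ENNReal.ofReal (ε ^ 2) := by
          simp; ring
      _ ≤ ∑ j, 16 * ∑ θ, R θ j := Finset.sum_le_sum fun j _ => hsum j
      _ = 16 * ∑ θ, ∑ j, R θ j := by rw [← Finset.mul_sum, Finset.sum_comm]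
      _ ≤ 16 * ∑ _θ : Fin k → Bool, S := by
          gcongr with θ
          exact hbessel θ
      _ = _ := by simp; ring
  rw [ENNReal.mul_le_mul_iff_right (by simp) (by finiteness)] at htotal
  rw [ENNReal.ofReal_div_of_pos (by norm_num), ENNReal.ofReal_mul (by positivity)]
  refine ENNReal.div_le_of_le_mul ?_
  simpa [mul_comm] using htotal

/-! ### The cube lies in the sparse class -/

theorem nthLargestAbs_le {a : ℕ → ℝ} {i : ℕ} {t : ℝ} (ht : 0 ≤ t)
    (h : {j | t < |a j|}.encard < (i : ℕ∞)) : nthLargestAbs a i ≤ t :=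
  csInf_le ⟨0, fun _ hs => hs.1⟩ ⟨ht, h⟩

/-- The weak `ℓ^p` norm of a sequence of `k` terms bounded by `ε`. -/
theorem weakLpNorm_le_of_support {p ε : ℝ} (hp : 0 < p) (hε : 0 ≤ ε) {k : ℕ} {a : ℕ → ℝ}
    (ha : ∀ i, |a i| ≤ ε) (hsupp : ∀ i, k ≤ i → a i = 0) :
    weakLpNorm p a ≤ ENNReal.ofReal ((k : ℝ) ^ (1 / p) * ε) := by
  refine iSup₂_le fun i hi => ENNReal.ofReal_le_ofReal ?_
  rcases le_or_gt i k with hik | hik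
  · have h : nthLargestAbs a i ≤ ε := by
      refine nthLargestAbs_le hε ?_
      rw [show {j | ε < |a j|} = ∅ from Set.eq_empty_of_forall_notMem fun j hj =>
        (ha j).not_gt hj, Set.encard_empty]
      exact_mod_cast hi
    calc (i : ℝ) ^ (1 / p) * nthLargestAbs a i ≤ (i : ℝ) ^ (1 / p) * ε := by gcongr
      _ ≤ (k : ℝ) ^ (1 / p) * ε := by gcongr
  · have h : nthLargestAbs a i ≤ 0 := by
      refine nthLargestAbs_le le_rfl ?_
      have hsub : {j | 0 < |a j|} ⊆ (Finset.range k : Set ℕ) := fun j hj => by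
        rw [Finset.coe_range, Set.mem_Iio]
        by_contra hjk
        simp [hsupp j (not_lt.1 hjk)] at hj
      refine (Set.encard_le_encard hsub).trans_lt ?_
      rw [Set.encard_coe_eq_coe_finsetCard, Finset.card_range]
      exact_mod_cast hik
    calc (i : ℝ) ^ (1 / p) * nthLargestAbs a i ≤ 0 :=
          mul_nonpos_of_nonneg_of_nonpos (by positivity) h
      _ ≤ _ := by positivity

/-- The vertices of a small hypercube in the first `k` coordinates are sparse. -/
theorem hypercubeVertex_mem_sparseApproxSet {d : ℕ} (φ : ℕ → L2Cube d) {p C₁ C₂ β ε : ℝ}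
    (hp : 0 < p) (hC₂ : 0 ≤ C₂) (hβ : 0 ≤ β) (hε : 0 ≤ ε) {k : ℕ}
    (h₁ : (k : ℝ) ^ (1 / p) * ε ≤ C₁) (h₂ : k * ε ^ 2 ≤ C₂ * (k : ℝ) ^ (-β)) (θ : Fin k → Bool) :
    hypercubeVertex (fun j => φ j) ε θ ∈ sparseApproxSet φ p C₁ C₂ β := by
  let a : ℕ → ℝ := fun i => if h : i < k then (if θ ⟨i, h⟩ then ε else 0) else 0
  have hsupp : ∀ i, k ≤ i → a i = 0 := fun i hi => dif_neg hi.not_gt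
  have habs : ∀ i, |a i| ≤ ε := fun i => by
    dsimp only [a]
    split_ifs <;> simp [abs_of_nonneg hε, hε]
  have hsq : ∀ i, a i ^ 2 ≤ ε ^ 2 := fun i => sq_le_sq.2 ((habs i).trans (le_abs_self ε))
  refine ⟨a, ?_, ?_, ?_, ?_⟩
  · refine memℓp_gen (summable_of_ne_finset_zero (s := Finset.range k) fun i hi => ?_)
    simp [hsupp i (by simpa using hi)]
  · have : hypercubeVertex (fun j => φ j) ε θ = ∑ i ∈ Finset.range k, a i • φ i := by
      rw [Finset.sum_range]
      exact Finset.sum_congr rfl fun j _ => by simp [a]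
    rw [this]
    refine hasSum_sum_of_ne_finset_zero fun i hi => ?_
    rw [hsupp i (by simpa using hi), zero_smul]
  · exact (weakLpNorm_le_of_support hp hε habs hsupp).trans (ENNReal.ofReal_le_ofReal h₁)
  · intro m hm
    have hm0 : (0 : ℝ) < m := by exact_mod_cast hm
    rw [tsum_eq_sum (s := Finset.range (k - m)) fun i hi => by
      rw [hsupp _ (by simp at hi; omega)]; simp]
    -- The tail vanishes once `m ≥ k`. For `m < k` it is at most the whole energy `k ε²`, and
    -- `m^(-β) ≥ k^(-β)`, so the tail condition is needed only at `k`.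
    rcases le_or_gt k m with hkm | hkm
    · rw [Nat.sub_eq_zero_of_le hkm]
      simp only [Finset.range_zero, Finset.sum_empty]
      positivity
    · calc ∑ i ∈ Finset.range (k - m), a (m + i) ^ 2 ≤ (k - m : ℕ) * ε ^ 2 := by
            simpa using Finset.sum_le_card_nsmul (Finset.range (k - m)) _ _
              fun i _ => hsq (m + i)
        _ ≤ k * ε ^ 2 := by gcongr; omega
        _ ≤ C₂ * (k : ℝ) ^ (-β) := h₂
        _ ≤ C₂ * (m : ℝ) ^ (-β) := by
            gcongr C₂ * ?_
            exact Real.rpow_le_rpow_of_nonpos hm0 (by exact_mod_cast hkm.le) (by linarith)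

/-! ### Choice of the dimension and side of the cube -/

theorem theorem4 (p C₁ C₂ σ α : ℝ) (hp0 : 0 < p) (hp2 : p < 2) (hC₁ : 0 < C₁) (hC₂ : 0 < C₂)
    (hσ : 0 < σ) (hα : α = 1 / p - 1 / 2) :
    ∃ C : ℝ, 0 < C ∧
      ∀ (d : ℕ) (φ : ℕ → L2Cube d), Orthonormal ℝ φ →
        ∀ β : ℝ, 0 < β → β ≤ 2 * α →
          ∀ n : ℕ, 2 ≤ n →
            ENNReal.ofReal (C * (n : ℝ) ^ (-(2 * α / (2 * α + 1))) *
                Real.log n ^ (-(4 * α ^ 2 / (2 * α + 1)))) ≤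
              minimaxRisk σ n (sparseApproxSet φ p C₁ C₂ β) := by
  have hα0 : 0 < α := by
    rw [hα, sub_pos]
    exact one_div_lt_one_div_of_lt hp0 hp2
  have hαp : 2 * α + 1 = 2 / p := by rw [hα]; ring
  set γ := 4 * α ^ 2 / (2 * α + 1) with hγ
  have hγ0 : 0 ≤ γ := by positivity
  -- One bound for each constraint: the weak norm (`c ≤ C₁`), the tails (`c² ≤ C₂`) and
  -- indistinguishability (`c² ≤ 4σ²`).
  set c := min C₁ (min (√C₂) (2 * σ)) with hc
  have hc0 : 0 < c := lt_min hC₁ (lt_min (Real.sqrt_pos.2 hC₂) (by positivity))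
  have hcC₁ : c ≤ C₁ := min_le_left _ _
  have hcC₂ : c ^ 2 ≤ C₂ := by
    rw [← Real.sq_sqrt hC₂.le]
    exact pow_le_pow_left₀ hc0.le ((min_le_right _ _).trans (min_le_left _ _)) 2
  have hcσ : c ^ 2 ≤ 4 * σ ^ 2 := by
    rw [show 4 * σ ^ 2 = (2 * σ) ^ 2 by ring]
    exact pow_le_pow_left₀ hc0.le ((min_le_right _ _).trans (min_le_right _ _)) 2
  have hlog2 : 0 < Real.log 2 := Real.log_pos one_lt_two
  -- `c²/16` comes from Assouad's bound, `2^(-2α)` from rounding `x` up to `k ≤ 2x`, and `(log 2)^γ`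
  -- from bounding the logarithmic factor over `n ≥ 2`.
  refine ⟨c ^ 2 / 16 * 2 ^ (-(2 * α)) * Real.log 2 ^ γ, by positivity, ?_⟩
  intro d φ hφ β hβ hβα n hn
  have hn2 : (2 : ℝ) ≤ n := by exact_mod_cast hn
  have hn0 : (0 : ℝ) < n := by linarith
  have hlogn : Real.log 2 ≤ Real.log n := Real.log_le_log two_pos hn2
  -- Solves `x^(2α+1) = n`, the smallest dimension for which `n ε² ≤ c²`.
  set x : ℝ := (n : ℝ) ^ (1 / (2 * α + 1)) with hx
  have hx1 : 1 ≤ x := Real.one_le_rpow (by linarith) (by positivity)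
  set k := ⌈x⌉₊
  have hxk : x ≤ k := Nat.le_ceil x
  have hk1 : (1 : ℝ) ≤ k := hx1.trans hxk
  have hk0 : (0 : ℝ) < k := by linarith
  have hk2x : (k : ℝ) ≤ 2 * x := by
    have := Nat.ceil_lt_add_one (show 0 ≤ x by linarith)
    linarith
  set ε := c * (k : ℝ) ^ (-(1 / p)) with hε
  have hε0 : 0 ≤ ε := by positivity
  have hε2 : ε ^ 2 = c ^ 2 * (k : ℝ) ^ (-(2 * α + 1)) := by
    rw [hε, mul_pow, ← Real.rpow_natCast, ← Real.rpow_natCast, ← Real.rpow_mul hk0.le, hαp]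
    congr 2
    push_cast
    ring
  have hkε : k * ε ^ 2 = c ^ 2 * (k : ℝ) ^ (-(2 * α)) := by
    rw [hε2, mul_left_comm, neg_add, Real.rpow_add hk0, Real.rpow_neg_one]
    field_simp
  have h₁ : (k : ℝ) ^ (1 / p) * ε ≤ C₁ := by
    rw [hε, mul_left_comm, ← Real.rpow_add hk0, add_neg_cancel, Real.rpow_zero, mul_one]
    exact hcC₁
  -- The only use of `β ≤ 2α`: since `k ≥ 1`, `k^(-2α) ≤ k^(-β)`. The constant thus stays free of
  -- `β`.
  have h₂ : k * ε ^ 2 ≤ C₂ * (k : ℝ) ^ (-β) := by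
    rw [hkε]
    gcongr
  have h₃ : n * ε ^ 2 ≤ 4 * σ ^ 2 := by
    have hnk : (n : ℝ) ≤ (k : ℝ) ^ (2 * α + 1) := by
      calc (n : ℝ) = x ^ (2 * α + 1) := by
            rw [hx, ← Real.rpow_mul hn0.le, one_div_mul_cancel (by positivity), Real.rpow_one]
        _ ≤ _ := by gcongr
    calc n * ε ^ 2 ≤ (k : ℝ) ^ (2 * α + 1) * ε ^ 2 := by gcongr
      _ = c ^ 2 := by
          rw [hε2, mul_left_comm, ← Real.rpow_add hk0, add_neg_cancel, Real.rpow_zero, mul_one]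
      _ ≤ _ := hcσ
  have hrate : c ^ 2 / 16 * 2 ^ (-(2 * α)) * Real.log 2 ^ γ *
      (n : ℝ) ^ (-(2 * α / (2 * α + 1))) * Real.log n ^ (-γ) ≤ k * ε ^ 2 / 16 := by
    have hlog : Real.log 2 ^ γ * Real.log n ^ (-γ) ≤ 1 := by
      rw [Real.rpow_neg (hlog2.le.trans hlogn), ← div_eq_mul_inv]
      exact div_le_one_of_le₀ (by gcongr) (by positivity)
    have hpow : 2 ^ (-(2 * α)) * (n : ℝ) ^ (-(2 * α / (2 * α + 1))) ≤ (k : ℝ) ^ (-(2 * α)) := by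
      calc _ = (2 * x) ^ (-(2 * α)) := by
            rw [Real.mul_rpow zero_le_two (by linarith), hx, ← Real.rpow_mul hn0.le]
            congr 2
            ring
        _ ≤ _ := Real.rpow_le_rpow_of_nonpos hk0 hk2x (by linarith)
    calc _ = c ^ 2 / 16 * (2 ^ (-(2 * α)) * (n : ℝ) ^ (-(2 * α / (2 * α + 1)))) *
          (Real.log 2 ^ γ * Real.log n ^ (-γ)) := by ring
      _ ≤ c ^ 2 / 16 * (k : ℝ) ^ (-(2 * α)) * 1 := by
          have : 0 ≤ Real.log n := hlog2.le.trans hlogn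
          gcongr
      _ = _ := by rw [hkε]; ring
  refine (ENNReal.ofReal_le_ofReal hrate).trans (le_iInf₂ fun fhat hfhat => ?_)
  exact hypercube_risk_lower_bound hσ (by omega) (hφ.comp _ Fin.val_injective) h₃
    (fun θ => hypercubeVertex_mem_sparseApproxSet φ hp0 hC₂.le hβ.le hε0 h₁ h₂ θ) hfhat
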